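/- Let $\mathrm{CZF}^-$ be the theory, in intuitionistic first-order logic with equality, whose axioms are Extensionality, Pair, Union, Restricted Separation, Strong Collection, Infinity and Set Induction (i.e. $\mathrm{CZF}$ without Subset Collection). As usual, classes are given by formulas with parameters, and $\mathrm V$ is the class of all sets. A (large) $\bigvee$-semilattice is a class $L$ with a class relation $\le$ that is reflexive, transitive and antisymmetric on $L$, such that every subset of $L$ has a supremum in $L$. It is *set-generated by a set* $B\subseteq L$ if, for every $x\in L$, the class $\downarrow x=\{b\in B\mid b\le x\}$ is a set and $x=\bigvee\downarrow x$. An *abstract inductive definition on* $L$ is any class of ordered pairs $\Phi\subseteq B\times L$. A class $Y\subseteq B$ is *$c_L$-closed* if $\downarrow\bigvee U\subseteq Y$ for every subset $U$ of $Y$; it is *$\Phi$-closed* if it is $c_L$-closed and, whenever $(b,a)\in\Phi$ and $\downarrow a\subseteq Y$, then $b\in Y$. For a class $Y\subseteq B$ put $$c_LY=\{b\in B\mid \text{there is a set } U\subseteq B \text{ with } U\subseteq Y \text{ and } b\le\bigvee U\},$$ $$\bar\Gamma_\Phi(Y)=c_L\{b\in B\mid \exists a\,((b,a)\in\Phi\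 \&\ \downarrow a\subseteq Y)\}.$$ For a class $J\subseteq\mathrm V\times B$ and a set $\alpha$ put $J^\alpha=\{y\in B\mid(\alpha,y)\in J\}$, $J^{\in\alpha}=\bigcup_{\beta\in\alpha}J^\beta$ and $J^\infty=\bigcup_{\alpha\in\mathrm V}J^\alpha$. **Theorem.** Let $L$ and $\le$ be classes, let $B$ be a set and let $\Phi$ be a class. There is a class $J$, given by a formula whose parameters are among $B$ and the parameters of $L$, $\le$ and $\Phi$, such that $\mathrm{CZF}^-$ proves the following. If $L$, ordered by $\le$, is a $\bigvee$-semilattice set-generated by $B$, and $\Phi\subseteq B\times L$ is an abstract inductive definition on $L$, then: 1. $J\subseteq\mathrm V\times B$ and $c_LJ^\alpha=\bar\Gamma_\Phi(c_LJ^{\in\alpha})$ for every set $\alpha$; 2. the class $c_LJ^\infty$ is $\Phi$-closed; 3. (scheme) for every class $C\subseteq B$, if $C$ is $\Phi$-closed, then $c_LJ^\infty\subseteq C$. In particular the least $\Phi$-closed class $\mathcal I(\Phi)=c_LJ^\infty$ exists. -/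

import Mathlib

/-! # Provability in the constructive set theory `CZF⁻`

First-order formulas over `∈` and `=`, intuitionistic natural deduction, the axioms of `CZF⁻`,
and the class notions of set-generated join-semilattices and abstract inductive definitions,
all as formulas of the language of set theory. -/

namespace CST

/-! ## Formulas and intuitionistic predicate logic with equality -/

/-- Formulas of the language of set theory, with de Bruijn indices. The only terms are
variables. `all` and `ex` bind the variable `0` of their body, in which the variable `n` of the
surrounding context is called `n + 1`. Negation is `φ → ⊥`. -/
inductive Fm : Type
  | mem (i j : ℕ) : Fm
  | eq (i j : ℕ) : Fm
  | bot : Fm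
  | and (φ ψ : Fm) : Fm
  | or (φ ψ : Fm) : Fm
  | imp (φ ψ : Fm) : Fm
  | all (φ : Fm) : Fm
  | ex (φ : Fm) : Fm

/-- The extension of a renaming of variables to the scope of one more binder. -/
def up (f : ℕ → ℕ) : ℕ → ℕ
  | 0 => 0
  | n + 1 => f n + 1

/-- Simultaneous (capture-avoiding) substitution of variables for the free variables. -/
def Fm.ren (f : ℕ → ℕ) : Fm → Fm
  | .mem i j => .mem (f i) (f j)
  | .eq i j => .eq (f i) (f j)
  | .bot => .bot
  | .and φ ψ => .and (φ.ren f) (ψ.ren f)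
  | .or φ ψ => .or (φ.ren f) (ψ.ren f)
  | .imp φ ψ => .imp (φ.ren f) (ψ.ren f)
  | .all φ => .all (φ.ren (up f))
  | .ex φ => .ex (φ.ren (up f))

/-- Weakening under one binder. -/
def Fm.shift (φ : Fm) : Fm := φ.ren Nat.succ

/-- The renaming `0 ↦ t`, `n + 1 ↦ n`. -/
def point (t : ℕ) : ℕ → ℕ
  | 0 => t
  | n + 1 => n

/-- The instance `φ[t/0]` of the body `φ` of a quantifier. -/
def Fm.inst (φ : Fm) (t : ℕ) : Fm := φ.ren (point t)

/-- The free variables. -/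
def Fm.fv : Fm → Set ℕ
  | .mem i j => {i, j}
  | .eq i j => {i, j}
  | .bot => ∅
  | .and φ ψ => φ.fv ∪ ψ.fv
  | .or φ ψ => φ.fv ∪ ψ.fv
  | .imp φ ψ => φ.fv ∪ ψ.fv
  | .all φ => {n | n + 1 ∈ φ.fv}
  | .ex φ => {n | n + 1 ∈ φ.fv}

/-- Natural deduction for intuitionistic predicate logic with equality: `Prf T Γ φ` says that `φ`
is derivable from the axioms `T` and the assumptions `Γ`. Free variables in axioms are read as
universally quantified, free variables in assumptions are fixed parameters. -/
inductive Prf (T : Fm → Prop) : List Fm → Fm → Prop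
  | ax {Γ : List Fm} {φ : Fm} : T φ → Prf T Γ φ
  | hyp {Γ : List Fm} {φ : Fm} : φ ∈ Γ → Prf T Γ φ
  | botE {Γ : List Fm} {φ : Fm} : Prf T Γ .bot → Prf T Γ φ
  | andI {Γ : List Fm} {φ ψ : Fm} : Prf T Γ φ → Prf T Γ ψ → Prf T Γ (.and φ ψ)
  | andE₁ {Γ : List Fm} {φ ψ : Fm} : Prf T Γ (.and φ ψ) → Prf T Γ φ
  | andE₂ {Γ : List Fm} {φ ψ : Fm} : Prf T Γ (.and φ ψ) → Prf T Γ ψ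
  | orI₁ {Γ : List Fm} {φ ψ : Fm} : Prf T Γ φ → Prf T Γ (.or φ ψ)
  | orI₂ {Γ : List Fm} {φ ψ : Fm} : Prf T Γ ψ → Prf T Γ (.or φ ψ)
  | orE {Γ : List Fm} {φ ψ χ : Fm} :
      Prf T Γ (.or φ ψ) → Prf T (φ :: Γ) χ → Prf T (ψ :: Γ) χ → Prf T Γ χ
  | impI {Γ : List Fm} {φ ψ : Fm} : Prf T (φ :: Γ) ψ → Prf T Γ (.imp φ ψ)
  | impE {Γ : List Fm} {φ ψ : Fm} : Prf T Γ (.imp φ ψ) → Prf T Γ φ → Prf T Γ ψ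
  | allI {Γ : List Fm} {φ : Fm} : Prf T (Γ.map Fm.shift) φ → Prf T Γ (.all φ)
  | allE {Γ : List Fm} {φ : Fm} (t : ℕ) : Prf T Γ (.all φ) → Prf T Γ (φ.inst t)
  | exI {Γ : List Fm} {φ : Fm} (t : ℕ) : Prf T Γ (φ.inst t) → Prf T Γ (.ex φ)
  | exE {Γ : List Fm} {φ ψ : Fm} :
      Prf T Γ (.ex φ) → Prf T (φ :: Γ.map Fm.shift) ψ.shift → Prf T Γ ψ
  | eqI {Γ : List Fm} (t : ℕ) : Prf T Γ (.eq t t)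
  | eqE {Γ : List Fm} (φ : Fm) {s t : ℕ} :
      Prf T Γ (.eq s t) → Prf T Γ (φ.inst s) → Prf T Γ (φ.inst t)

/-- Restricted formulas: every quantifier occurs in the form `(∀ x ∈ b)` or `(∃ x ∈ b)`, where
`b` is a variable different from `x`. -/
inductive Restricted : Fm → Prop
  | mem (i j : ℕ) : Restricted (.mem i j)
  | eq (i j : ℕ) : Restricted (.eq i j)
  | bot : Restricted .bot
  | and {φ ψ : Fm} : Restricted φ → Restricted ψ → Restricted (.and φ ψ)
  | or {φ ψ : Fm} : Restricted φ → Restricted ψ → Restricted (.or φ ψ)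
  | imp {φ ψ : Fm} : Restricted φ → Restricted ψ → Restricted (.imp φ ψ)
  | all {φ : Fm} (b : ℕ) : Restricted φ → Restricted (.all (.imp (.mem 0 (b + 1)) φ))
  | ex {φ : Fm} (b : ℕ) : Restricted φ → Restricted (.ex (.and (.mem 0 (b + 1)) φ))

/-! ## Writing formulas with named bound variables

To write formulas without de Bruijn indices, a variable is given by its index at each binder
depth, and a formula by its de Bruijn form at each binder depth. A formula `F : Fml` without
surrounding binders is the formula `F 0`. -/

/-- A variable, as a function from the binder depth to its index at this depth. -/
abbrev Var := ℕ → ℕ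

/-- A formula, as a function from the binder depth to its de Bruijn form at this depth. -/
abbrev Fml := ℕ → Fm

/-- A class `{x | φ(x)}`; `C x` is the formula `x ∈ C`. -/
abbrev Cls := Var → Fml

/-- The free variable (parameter) `n`. -/
def param (n : ℕ) : Var := fun k => n + k

def memV (x y : Var) : Fml := fun k => .mem (x k) (y k)
def eqV (x y : Var) : Fml := fun k => .eq (x k) (y k)
def andF (φ ψ : Fml) : Fml := fun k => .and (φ k) (ψ k)
def orF (φ ψ : Fml) : Fml := fun k => .or (φ k) (ψ k)
def impF (φ ψ : Fml) : Fml := fun k => .imp (φ k) (ψ k)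

infix:50 " ∈ₛ " => memV
infix:50 " =ₛ " => eqV
infixr:35 " ∧ₛ " => andF
infixr:30 " ∨ₛ " => orF
infixr:25 " →ₛ " => impF

def iffF (φ ψ : Fml) : Fml := (φ →ₛ ψ) ∧ₛ (ψ →ₛ φ)

infix:20 " ↔ₛ " => iffF

/-- `∀ x, φ x`. The variable bound at depth `k` has index `0` at depth `k + 1`, index `1` at depth
`k + 2`, and so on. -/
def allV (φ : Var → Fml) : Fml := fun k => .all (φ (fun m => m - (k + 1)) (k + 1))

/-- `∃ x, φ x`. -/
def exV (φ : Var → Fml) : Fml := fun k => .ex (φ (fun m => m - (k + 1)) (k + 1))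

/-- `(∀ x ∈ C) φ x`. -/
def allIn (C : Cls) (φ : Var → Fml) : Fml := allV fun x => C x →ₛ φ x

/-- `(∃ x ∈ C) φ x`. -/
def exIn (C : Cls) (φ : Var → Fml) : Fml := exV fun x => C x ∧ₛ φ x

/-- The class `{x | x ∈ a}` of the elements of a set. -/
def ofSet (a : Var) : Cls := fun x => x ∈ₛ a

/-- The class `{x | φ(x)}` given by a formula `φ`, in which the variable `0` stands for `x` and
the variable `n + 1` for the parameter `n`. -/
def cls (φ : Fm) : Cls := fun x k => φ.ren fun
  | 0 => x k
  | n + 1 => n + k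

/-- `φ(x, y)`, for a formula `φ`, in which the variables `0` and `1` stand for `x` and `y` and the
variable `n + 2` for the parameter `n`. -/
def rel (φ : Fm) : Var → Var → Fml := fun x y k => φ.ren fun
  | 0 => x k
  | 1 => y k
  | n + 2 => n + k

/-- Inclusion of classes. -/
def subC (X Y : Cls) : Fml := allIn X fun x => Y x

/-- Equality (extensional) of classes. -/
def eqC (X Y : Cls) : Fml := allV fun x => X x ↔ₛ Y x

/-! ## The axioms of `CZF⁻` -/

/-- The axioms of `CZF⁻`, i.e. those of `CZF` without Subset Collection. Formulas in the schemes
may contain arbitrary parameters. -/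
inductive CZFMinus : Fm → Prop
  | extensionality : CZFMinus ((allV fun a => allV fun b =>
      (allV fun y => y ∈ₛ a ↔ₛ y ∈ₛ b) →ₛ a =ₛ b) 0)
  | pair : CZFMinus ((allV fun a => allV fun b => exV fun x => allV fun y =>
      y ∈ₛ x ↔ₛ (y =ₛ a ∨ₛ y =ₛ b)) 0)
  | union : CZFMinus ((allV fun a => exV fun x => allV fun y =>
      y ∈ₛ x ↔ₛ exIn (ofSet a) fun z => y ∈ₛ z) 0)
  | restrictedSeparation (φ : Fm) : Restricted φ →
      CZFMinus ((allV fun a => exV fun x => allV fun y =>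
        y ∈ₛ x ↔ₛ (y ∈ₛ a ∧ₛ cls φ y)) 0)
  | strongCollection (φ : Fm) : CZFMinus ((allV fun a =>
      (allIn (ofSet a) fun x => exV fun y => rel φ x y) →ₛ
        exV fun b =>
          (allIn (ofSet a) fun x => exIn (ofSet b) fun y => rel φ x y) ∧ₛ
          (allIn (ofSet b) fun y => exIn (ofSet a) fun x => rel φ x y)) 0)
  | infinity : CZFMinus ((exV fun a => (exV fun x => x ∈ₛ a) ∧ₛ
      allIn (ofSet a) fun x => exIn (ofSet a) fun y => x ∈ₛ y) 0)
  | setInduction (φ : Fm) : CZFMinus (((allV fun a =>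
      (allIn (ofSet a) fun x => cls φ x) →ₛ cls φ a) →ₛ allV fun a => cls φ a) 0)

/-- `CZF⁻` proves the formula `φ` (for all values of its parameters). -/
def CZFMinusProves (φ : Fml) : Prop := Prf CZFMinus [] (φ 0)

/-! ## Ordered pairs -/

/-- `z = {x, y}`. -/
def isUnordPair (z x y : Var) : Fml := allV fun w => w ∈ₛ z ↔ₛ (w =ₛ x ∨ₛ w =ₛ y)

/-- `z = (x, y) = {{x}, {x, y}}`. -/
def isPair (z x y : Var) : Fml :=
  allV fun w => w ∈ₛ z ↔ₛ (isUnordPair w x x ∨ₛ isUnordPair w x y)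

/-- `(x, y) ∈ R`. -/
def pairIn (R : Cls) (x y : Var) : Fml := exV fun z => isPair z x y ∧ₛ R z

/-- `R ⊆ X × Y`. -/
def subProd (R X Y : Cls) : Fml :=
  allIn R fun z => exIn X fun x => exIn Y fun y => isPair z x y

/-- The class of all sets. -/
def univC : Cls := fun x => x =ₛ x

/-! ## Set-generated join-semilattices -/

section Semilattice

/-- `(L, ≤)` is a partially ordered class. Here `Le` is the class of the pairs `(x, y)` with
`x ≤ y`. -/
def isPoclass (L Le : Cls) : Fml :=
  (allIn L fun x => pairIn Le x x) ∧ₛ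
  (allIn L fun x => allIn L fun y => allIn L fun z =>
    pairIn Le x y →ₛ pairIn Le y z →ₛ pairIn Le x z) ∧ₛ
  (allIn L fun x => allIn L fun y => pairIn Le x y →ₛ pairIn Le y x →ₛ x =ₛ y)

/-- `s` is the supremum in `L` of the set `U`. -/
def isSup (L Le : Cls) (U s : Var) : Fml :=
  L s ∧ₛ (allIn (ofSet U) fun x => pairIn Le x s) ∧ₛ
  (allIn L fun t => (allIn (ofSet U) fun x => pairIn Le x t) →ₛ pairIn Le s t)

/-- `(L, ≤)` is a (large) join-semilattice: a partially ordered class in which every subset has a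
supremum. -/
def isJoinSemilattice (L Le : Cls) : Fml :=
  isPoclass L Le ∧ₛ
  allV fun U => subC (ofSet U) L →ₛ exV fun s => isSup L Le U s

/-- The class `↓x = {b ∈ B | b ≤ x}`. -/
def down (Le : Cls) (B x : Var) : Cls := fun b => b ∈ₛ B ∧ₛ pairIn Le b x

/-- The set `B` is a generating set for `L`: it is a subset of `L` and for each `x ∈ L` the class
`↓x` is a set whose supremum is `x`. -/
def isGenerating (L Le : Cls) (B : Var) : Fml :=
  subC (ofSet B) L ∧ₛ
  allIn L fun x => exV fun D => eqC (ofSet D) (down Le B x) ∧ₛ isSup L Le D x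

/-! ## Abstract inductive definitions -/

/-- `L` is a join-semilattice set-generated by the set `B`, and `Φ ⊆ B × L` is an abstract
inductive definition on `L`. -/
def isAbstractInductiveDefinition (L Le : Cls) (B : Var) (Φ : Cls) : Fml :=
  isJoinSemilattice L Le ∧ₛ isGenerating L Le B ∧ₛ subProd Φ (ofSet B) L

/-- `↓⋁U ⊆ Y` for each subset `U` of the class `Y`. -/
def isCLClosed (L Le : Cls) (B : Var) (Y : Cls) : Fml :=
  allV fun U => subC (ofSet U) Y →ₛ
    allV fun s => isSup L Le U s →ₛ subC (down Le B s) Y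

/-- The class `Y` is a `Φ`-closed subclass of `B`: it is `c_L`-closed, and `↓a ⊆ Y` implies
`b ∈ Y` whenever `(b, a) ∈ Φ`. -/
def isPhiClosed (L Le : Cls) (B : Var) (Φ Y : Cls) : Fml :=
  subC Y (ofSet B) ∧ₛ isCLClosed L Le B Y ∧ₛ
  allV fun b => allV fun a => pairIn Φ b a →ₛ subC (down Le B a) Y →ₛ Y b

/-- `c_L Y`, the union of the classes `↓⋁U` for `U` a subset of `B` with `U ⊆ Y`. -/
def cL (L Le : Cls) (B : Var) (Y : Cls) : Cls := fun b =>
  b ∈ₛ B ∧ₛ exV fun U => subC (ofSet U) (ofSet B) ∧ₛ subC (ofSet U) Y ∧ₛ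
    exV fun s => isSup L Le U s ∧ₛ down Le B s b

/-- The operator `Γ̄(Y) = c_L {b ∈ B | ∃ a, (b, a) ∈ Φ and ↓a ⊆ Y}`. -/
def gammaBar (L Le : Cls) (B : Var) (Φ Y : Cls) : Cls :=
  cL L Le B fun b => b ∈ₛ B ∧ₛ exV fun a => pairIn Φ b a ∧ₛ subC (down Le B a) Y

/-- `J^α = {y ∈ B | (α, y) ∈ J}`. -/
def stage (B : Var) (J : Cls) (α : Var) : Cls := fun y => y ∈ₛ B ∧ₛ pairIn J α y

/-- `J^{∈α} = {y ∈ B | (∃ β ∈ α) (β, y) ∈ J}`. -/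
def stageBelow (B : Var) (J : Cls) (α : Var) : Cls := fun y =>
  y ∈ₛ B ∧ₛ exIn (ofSet α) fun β => pairIn J β y

/-- `J^∞ = {y ∈ B | ∃ α, (α, y) ∈ J}`. -/
def stageInfty (B : Var) (J : Cls) : Cls := fun y =>
  y ∈ₛ B ∧ₛ exV fun α => pairIn J α y

/-- `J ⊆ V × B` is an iteration of `Γ̄` along all sets: `c_L J^α = Γ̄(c_L J^{∈α})` for every
set `α`. -/
def isIteration (L Le : Cls) (B : Var) (Φ J : Cls) : Fml :=
  subProd J univC (ofSet B) ∧ₛ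
  allV fun α => eqC (cL L Le B (stage B J α))
    (gammaBar L Le B Φ (cL L Le B (stageBelow B J α)))

end Semilattice

end CST

open CST

namespace CST

/-! Call a set G of pairs justified if each (α, b) ∈ G has some (b, a) ∈ Φ with ↓a ⊆ c_L G^{∈α}, and
let J be the union of all justified sets. Put Γ(Y) = {b ∈ B | ∃ a, (b, a) ∈ Φ and ↓a ⊆ Y}. Then J^α
= Γ(c_L J^{∈α}) already holds before c_L is applied to both sides. One inclusion is monotonicity,
since a justified G is contained in J (`goodT_stage`). For the other, ↓a is a set, so Strong
Collection merges the covers of its elements into one set W ⊆ J^{∈α} (`ForcesAID.cover`). A second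
collection gathers justified sets for the elements of W; their union is justified (`goodT_union`),
and it stays so when (α, b) is adjoined (`goodT_insert`).

For Φ-closure of c_L J^∞, the stages at which the elements of a cover W of ↓a appear are collected
into one set α, whence b ∈ J^α. Leastness is Set Induction on α.

The claims concern derivability in a formal calculus, so this argument runs inside a forcing
semantics. Worlds are finite contexts, individuals are variables, and truth values are monotone
predicates on worlds that are local for the coverage given by provability. Forcing a formula
coincides with proving it (`forces_sat`), so derivations become ordinary reasoning about truth
values. Definability by a formula is needed only for equality and for the schemes; `Def₁` and `Def₂`
record it. -/

/-! ## Renaming -/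

/-- The environment with `0 ↦ a` and `n + 1 ↦ ρ n`. -/
def scons (a : ℕ) (ρ : ℕ → ℕ) : ℕ → ℕ
  | 0 => a
  | n + 1 => ρ n

@[simp] theorem scons_zero (a : ℕ) (ρ : ℕ → ℕ) : scons a ρ 0 = a := rfl
@[simp] theorem scons_succ (a : ℕ) (ρ : ℕ → ℕ) (n : ℕ) : scons a ρ (n + 1) = ρ n := rfl

theorem Fm.ren_congr {φ : Fm} : ∀ {f g : ℕ → ℕ}, (∀ n ∈ φ.fv, f n = g n) →
    φ.ren f = φ.ren g := by
  have key : ∀ {ψ : Fm} {f g : ℕ → ℕ}, (∀ n ∈ {n | n + 1 ∈ ψ.fv}, f n = g n) →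
      ∀ n ∈ ψ.fv, up f n = up g n := by
    intro ψ f g h n hn
    cases n with
    | zero => rfl
    | succ n => exact congrArg (· + 1) (h n hn)
  induction φ with
  | mem i j => intro f g h; simp only [ren]; rw [h i (by simp [fv]), h j (by simp [fv])]
  | eq i j => intro f g h; simp only [ren]; rw [h i (by simp [fv]), h j (by simp [fv])]
  | bot => intros; rfl
  | and φ ψ h₁ h₂ | or φ ψ h₁ h₂ | imp φ ψ h₁ h₂ =>
    intro f g h
    simp only [ren]
    rw [h₁ fun n hn => h n (Or.inl hn), h₂ fun n hn => h n (Or.inr hn)]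
  | all φ ih | ex φ ih => intro f g h; simp only [ren]; rw [ih (key h)]

theorem up_comp (f g : ℕ → ℕ) : up g ∘ up f = up (g ∘ f) := by
  funext n; cases n <;> rfl

theorem Fm.ren_ren (φ : Fm) : ∀ f g : ℕ → ℕ, (φ.ren f).ren g = φ.ren (g ∘ f) := by
  induction φ <;> intro f g <;> simp_all [ren, up_comp]

theorem up_id : up id = id := by funext n; cases n <;> rfl

theorem Fm.ren_id (φ : Fm) : φ.ren id = φ := by
  induction φ <;> simp_all [ren, up_id]

theorem Fm.mem_fv_ren {φ : Fm} : ∀ {f : ℕ → ℕ} {n : ℕ}, n ∈ (φ.ren f).fv →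
    ∃ m ∈ φ.fv, f m = n := by
  have key : ∀ {ψ : Fm} {f : ℕ → ℕ} {n : ℕ}, (∃ m ∈ ψ.fv, up f m = n + 1) →
      ∃ m ∈ {m | m + 1 ∈ ψ.fv}, f m = n := by
    rintro ψ f n ⟨m, hm, h⟩
    cases m with
    | zero => cases h
    | succ m => exact ⟨m, hm, Nat.succ.inj h⟩
  induction φ with
  | mem i j | eq i j =>
    rintro f n (h | h)
    · exact ⟨i, Or.inl rfl, h.symm⟩
    · exact ⟨j, Or.inr rfl, h.symm⟩
  | bot => intro f n h; exact h.elim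
  | and φ ψ h₁ h₂ | or φ ψ h₁ h₂ | imp φ ψ h₁ h₂ =>
    rintro f n (h | h)
    · obtain ⟨m, hm, e⟩ := h₁ h; exact ⟨m, Or.inl hm, e⟩
    · obtain ⟨m, hm, e⟩ := h₂ h; exact ⟨m, Or.inr hm, e⟩
  | all φ ih | ex φ ih => intro f n h; exact key (ih h)

theorem Fm.exists_fv_lt (φ : Fm) : ∃ N, ∀ n ∈ φ.fv, n < N := by
  induction φ with
  | mem i j | eq i j => exact ⟨i + j + 1, by rintro n (rfl | rfl) <;> omega⟩
  | bot => exact ⟨0, fun n h => h.elim⟩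
  | and φ ψ h₁ h₂ | or φ ψ h₁ h₂ | imp φ ψ h₁ h₂ =>
    obtain ⟨M, hM⟩ := h₁
    obtain ⟨N, hN⟩ := h₂
    refine ⟨M + N, ?_⟩
    rintro n (h | h)
    · have := hM n h; omega
    · have := hN n h; omega
  | all φ ih | ex φ ih =>
    obtain ⟨N, hN⟩ := ih
    exact ⟨N, fun n h => by have := hN _ h; omega⟩

theorem exists_fv_lt_of_list (Γ : List Fm) : ∃ N, ∀ φ ∈ Γ, ∀ n ∈ φ.fv, n < N := by
  induction Γ with
  | nil => exact ⟨0, by simp⟩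
  | cons φ Γ ih =>
    obtain ⟨M, hM⟩ := φ.exists_fv_lt
    obtain ⟨N, hN⟩ := ih
    refine ⟨M + N, fun ψ hψ n hn => ?_⟩
    rcases List.mem_cons.1 hψ with rfl | hψ
    · have := hM n hn; omega
    · have := hN ψ hψ n hn; omega

theorem Fm.inst_ren (φ : Fm) (t : ℕ) (f : ℕ → ℕ) :
    (φ.inst t).ren f = (φ.ren (up f)).inst (f t) := by
  simp only [inst, ren_ren]
  congr 1; funext n; cases n <;> rfl

theorem Fm.shift_ren (φ : Fm) (f : ℕ → ℕ) : φ.shift.ren (up f) = (φ.ren f).shift := by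
  simp only [shift, ren_ren]; rfl

theorem Fm.ren_up_inst (φ : Fm) (ρ : ℕ → ℕ) (t : ℕ) :
    (φ.ren (up ρ)).inst t = φ.ren (scons t ρ) := by
  simp only [inst, ren_ren]
  congr 1; funext n; cases n <;> rfl

/-! ### Axioms and derivations under renaming -/

theorem Restricted.ren {φ : Fm} (h : Restricted φ) : ∀ f : ℕ → ℕ, Restricted (φ.ren f) := by
  induction h with
  | mem i j => exact fun f => .mem _ _
  | eq i j => exact fun f => .eq _ _
  | bot => exact fun f => .bot
  | and _ _ h₁ h₂ => exact fun f => .and (h₁ f) (h₂ f)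
  | or _ _ h₁ h₂ => exact fun f => .or (h₁ f) (h₂ f)
  | imp _ _ h₁ h₂ => exact fun f => .imp (h₁ f) (h₂ f)
  | all b _ ih => exact fun f => .all (f b) (ih (up f))
  | ex b _ ih => exact fun f => .ex (f b) (ih (up f))

/-- Under `k` binders a renaming `f` of the parameters acts as `g`, which fixes the bound variable
`x` and is `f` moved up by `k`. -/
theorem cls_ren {φ : Fm} {x : Var} {k : ℕ} {f g : ℕ → ℕ} (hx : g (x k) = x k)
    (hf : ∀ n, g (n + k) = f n + k) : (cls φ x k).ren g = cls (φ.ren (up f)) x k := by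
  simp only [cls, Fm.ren_ren]
  congr 1; funext n; rcases n with _ | n
  exacts [hx, hf n]

theorem rel_ren {φ : Fm} {x y : Var} {k : ℕ} {f g : ℕ → ℕ} (hx : g (x k) = x k)
    (hy : g (y k) = y k) (hf : ∀ n, g (n + k) = f n + k) :
    (rel φ x y k).ren g = rel (φ.ren (up (up f))) x y k := by
  simp only [rel, Fm.ren_ren]
  congr 1; funext n; rcases n with _ | _ | n
  exacts [hx, hy, hf n]

/-- The single axioms are closed, and renaming the parameters of an instance of a scheme gives the
instance for the renamed formula. -/
theorem CZFMinus.ren {φ : Fm} (h : CZFMinus φ) (f : ℕ → ℕ) : CZFMinus (φ.ren f) := by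
  cases h with
  | extensionality => exact extensionality
  | pair => exact pair
  | union => exact union
  | infinity => exact infinity
  | restrictedSeparation φ hφ =>
    have := restrictedSeparation (φ.ren (up f)) (hφ.ren _)
    simp only [allV, exV, iffF, impF, andF, memV, Fm.ren] at this ⊢
    rwa [cls_ren rfl fun _ => rfl]
  | strongCollection φ =>
    have := strongCollection (φ.ren (up (up f)))
    simp only [allV, exV, allIn, exIn, ofSet, impF, andF, memV, Fm.ren] at this ⊢
    rwa [rel_ren rfl rfl fun _ => rfl, rel_ren rfl rfl fun _ => rfl, rel_ren rfl rfl fun _ => rfl]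
  | setInduction φ =>
    have := setInduction (φ.ren (up f))
    simp only [allV, allIn, ofSet, impF, memV, Fm.ren] at this ⊢
    rwa [cls_ren rfl fun _ => rfl, cls_ren rfl fun _ => rfl]

theorem Prf.ren {Γ : List Fm} {φ : Fm} (h : Prf CZFMinus Γ φ) :
    ∀ f : ℕ → ℕ, Prf CZFMinus (Γ.map (Fm.ren f)) (φ.ren f) := by
  have key : ∀ (Γ : List Fm) (f : ℕ → ℕ),
      (Γ.map Fm.shift).map (Fm.ren (up f)) = (Γ.map (Fm.ren f)).map Fm.shift := by
    intro Γ f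
    simp [Function.comp_def, Fm.shift_ren]
  induction h with
  | ax h => exact fun f => .ax (h.ren f)
  | hyp h => exact fun f => .hyp (List.mem_map_of_mem h)
  | botE _ ih => exact fun f => .botE (ih f)
  | andI _ _ h₁ h₂ => exact fun f => .andI (h₁ f) (h₂ f)
  | andE₁ _ ih => exact fun f => .andE₁ (ih f)
  | andE₂ _ ih => exact fun f => .andE₂ (ih f)
  | orI₁ _ ih => exact fun f => .orI₁ (ih f)
  | orI₂ _ ih => exact fun f => .orI₂ (ih f)
  | orE _ _ _ h₁ h₂ h₃ => exact fun f => .orE (h₁ f) (h₂ f) (h₃ f)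
  | impI _ ih => exact fun f => .impI (ih f)
  | impE _ _ h₁ h₂ => exact fun f => .impE (h₁ f) (h₂ f)
  | allI _ ih => exact fun f => .allI (key _ f ▸ ih (up f))
  | allE t _ ih => exact fun f => Fm.inst_ren _ _ _ ▸ .allE (f t) (ih f)
  | exI t _ ih => exact fun f => .exI (f t) (Fm.inst_ren _ _ _ ▸ ih f)
  | @exE Γ φ ψ _ _ h₁ h₂ =>
    refine fun f => .exE (h₁ f) ?_
    have := h₂ (up f)
    rwa [List.map_cons, key, Fm.shift_ren] at this
  | eqI t => exact fun f => .eqI (f t)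
  | eqE φ _ _ h₁ h₂ =>
    intro f
    rw [Fm.inst_ren]
    exact .eqE _ (h₁ f) (Fm.inst_ren _ _ _ ▸ h₂ f)

/-! ### Weakening and fresh variables -/

theorem Prf.weaken {T : Fm → Prop} {Γ : List Fm} {φ : Fm} (h : Prf T Γ φ) :
    ∀ {Δ : List Fm}, Γ ⊆ Δ → Prf T Δ φ := by
  induction h with
  | ax h => exact fun _ => .ax h
  | hyp h => exact fun s => .hyp (s h)
  | botE _ ih => exact fun s => .botE (ih s)
  | andI _ _ h₁ h₂ => exact fun s => .andI (h₁ s) (h₂ s)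
  | andE₁ _ ih => exact fun s => .andE₁ (ih s)
  | andE₂ _ ih => exact fun s => .andE₂ (ih s)
  | orI₁ _ ih => exact fun s => .orI₁ (ih s)
  | orI₂ _ ih => exact fun s => .orI₂ (ih s)
  | orE _ _ _ h₁ h₂ h₃ =>
    exact fun s => .orE (h₁ s) (h₂ (List.cons_subset_cons _ s)) (h₃ (List.cons_subset_cons _ s))
  | impI _ ih => exact fun s => .impI (ih (List.cons_subset_cons _ s))
  | impE _ _ h₁ h₂ => exact fun s => .impE (h₁ s) (h₂ s)
  | allI _ ih => exact fun s => .allI (ih (List.map_subset _ s))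
  | allE t _ ih => exact fun s => .allE t (ih s)
  | exI t _ ih => exact fun s => .exI t (ih s)
  | exE _ _ h₁ h₂ =>
    exact fun s => .exE (h₁ s) (h₂ (List.cons_subset_cons _ (List.map_subset _ s)))
  | eqI t => exact fun _ => .eqI t
  | eqE φ _ _ h₁ h₂ => exact fun s => .eqE φ (h₁ s) (h₂ s)

/-- A renaming that turns a fresh variable `t` into the variable `0` bound by a new quantifier. -/
def abstr (t : ℕ) (n : ℕ) : ℕ := if n = t then 0 else n + 1

theorem Fm.ren_abstr {φ : Fm} {t : ℕ} (ht : ∀ n ∈ φ.fv, n < t) : φ.ren (abstr t) = φ.shift :=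
  ren_congr fun n hn => if_neg (ht n hn).ne

/-- The bound is `t + 1` because `φ` lies under a binder: its variable `n + 1` is the outer variable
`n`, which must differ from `t`. -/
theorem Fm.inst_ren_abstr {φ : Fm} {t : ℕ} (ht : ∀ n ∈ φ.fv, n < t + 1) :
    (φ.inst t).ren (abstr t) = φ := by
  rw [inst, ren_ren]
  conv_rhs => rw [← φ.ren_id]
  refine ren_congr fun n hn => ?_
  cases n with
  | zero => exact if_pos rfl
  | succ n =>
    have := ht _ hn
    exact if_neg (by simp only [point]; omega)

theorem map_ren_abstr {Γ : List Fm} {t : ℕ} (ht : ∀ φ ∈ Γ, ∀ n ∈ φ.fv, n < t) :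
    Γ.map (Fm.ren (abstr t)) = Γ.map Fm.shift :=
  List.map_congr_left fun φ hφ => Fm.ren_abstr (ht φ hφ)

/-- A finite context leaves some variable fresh. The instance at that variable, with the variable
abstracted by renaming, is the premise of `Prf.allI`. Hence individuals can be plain variables, with
the same domain at every world. -/
theorem Prf.all_of_forall {Γ : List Fm} {φ : Fm} (h : ∀ t, Prf CZFMinus Γ (φ.inst t)) :
    Prf CZFMinus Γ (.all φ) := by
  obtain ⟨N, hN⟩ := exists_fv_lt_of_list (φ :: Γ)
  have := (h N).ren (abstr N)
  rw [map_ren_abstr fun ψ hψ => hN ψ (List.mem_cons_of_mem _ hψ), Fm.inst_ren_abstr fun n hn =>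
    (hN φ List.mem_cons_self n hn).trans (Nat.lt_succ_self _)] at this
  exact .allI this

/-- Only the instance at a variable fresh for `φ`, `ψ` and the context is used, as in
`Prf.all_of_forall`. -/
theorem Prf.ex_elim {Γ : List Fm} {φ ψ : Fm} (h : Prf CZFMinus Γ (.ex φ))
    (k : ∀ t, Prf CZFMinus (φ.inst t :: Γ) ψ) : Prf CZFMinus Γ ψ := by
  obtain ⟨N, hN⟩ := exists_fv_lt_of_list (φ :: ψ :: Γ)
  have := (k N).ren (abstr N)
  rw [List.map_cons, map_ren_abstr fun ψ hψ => hN ψ (by simp [hψ]), Fm.inst_ren_abstr fun n hn =>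
    (hN φ List.mem_cons_self n hn).trans (Nat.lt_succ_self _),
    Fm.ren_abstr (hN ψ (by simp))] at this
  exact .exE h this

/-! ## Forcing -/

/-- Finite contexts extending `Γ₀`. -/
structure World (Γ₀ : List Fm) where
  ctx : List Fm
  sub : Γ₀ ⊆ ctx

variable {Γ₀ : List Fm}

instance : Preorder (World Γ₀) where
  le v w := v.ctx ⊆ w.ctx
  le_refl v := List.Subset.refl _
  le_trans _ _ _ h₁ h₂ := List.Subset.trans h₁ h₂

/-- The context `w` proves `φ`. -/
def World.Proves (w : World Γ₀) (φ : Fm) : Prop := Prf CZFMinus w.ctx φ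

theorem World.Proves.mono {v w : World Γ₀} {φ : Fm} (h : v.Proves φ) (hw : v ≤ w) :
    w.Proves φ :=
  Prf.weaken h hw

/-- The context `w, φ`. -/
def World.cons (φ : Fm) (w : World Γ₀) : World Γ₀ :=
  ⟨φ :: w.ctx, List.Subset.trans w.sub (List.subset_cons_self _ _)⟩

theorem World.le_cons (φ : Fm) (w : World Γ₀) : w ≤ w.cons φ := List.subset_cons_self _ _

theorem World.cons_proves (φ : Fm) (w : World Γ₀) : (w.cons φ).Proves φ :=
  .hyp List.mem_cons_self

/-- `w` proves every formula that is provable from `p`. -/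
def World.Covered (p : World Γ₀ → Prop) (w : World Γ₀) : Prop :=
  ∀ v, w ≤ v → ∀ ψ, (∀ u, v ≤ u → p u → u.Proves ψ) → v.Proves ψ

/-- Truth values: monotone predicates on contexts that are closed under coverings. -/
@[ext] structure Truth (Γ₀ : List Fm) where
  holds : World Γ₀ → Prop
  mono : ∀ {v w}, v ≤ w → holds v → holds w
  loc : ∀ {w}, w.Covered holds → holds w

/-- The truth value `p` holds at `w`. -/
def Forces (w : World Γ₀) (p : Truth Γ₀) : Prop := p.holds w

infix:20 " ⊩ " => Forces

theorem Forces.up {v w : World Γ₀} {p : Truth Γ₀} (h : v ⊩ p) (hw : v ≤ w := by order) : w ⊩ p :=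
  p.mono hw h

/-- The truth value of a formula. -/
def provT (φ : Fm) : Truth Γ₀ where
  holds w := w.Proves φ
  mono hw h := h.mono hw
  loc h := h _ le_rfl φ fun _ _ hu => hu

/-- The closure of a predicate to a truth value. -/
def closT (p : World Γ₀ → Prop) : Truth Γ₀ where
  holds w := w.Covered p
  mono hw h v hv := h v (hw.trans hv)
  loc h v hv ψ k := h v hv ψ fun u hu hp => hp u le_rfl ψ fun x hx => k x (hu.trans hx)

def botT : Truth Γ₀ := closT fun _ => False

def andT (p q : Truth Γ₀) : Truth Γ₀ where
  holds w := (w ⊩ p) ∧ (w ⊩ q)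
  mono hw h := ⟨h.1.up, h.2.up⟩
  loc h := ⟨p.loc fun v hv ψ k => h v hv ψ fun u hu hp => k u hu hp.1,
    q.loc fun v hv ψ k => h v hv ψ fun u hu hp => k u hu hp.2⟩

def orT (p q : Truth Γ₀) : Truth Γ₀ := closT fun w => (w ⊩ p) ∨ (w ⊩ q)

def impT (p q : Truth Γ₀) : Truth Γ₀ where
  holds w := ∀ v, w ≤ v → (v ⊩ p) → (v ⊩ q)
  mono hw h v hv := h v (hw.trans hv)
  loc {w} h v hv hp := q.loc fun u hu ψ k => h u (hv.trans hu) ψ fun x hx hpq =>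
    k x hx (hpq x le_rfl (hp.up))

def allT (p : ℕ → Truth Γ₀) : Truth Γ₀ where
  holds w := ∀ t, w ⊩ p t
  mono hw h t := (h t).up
  loc h t := (p t).loc fun v hv ψ k => h v hv ψ fun u hu hp => k u hu (hp t)

def exT (p : ℕ → Truth Γ₀) : Truth Γ₀ := closT fun w => ∃ t, w ⊩ p t

infixr:35 " ∧ₜ " => andT
infixr:30 " ∨ₜ " => orT
infixr:25 " →ₜ " => impT

def iffT (p q : Truth Γ₀) : Truth Γ₀ := (p →ₜ q) ∧ₜ (q →ₜ p)

infix:21 " ↔ₜ " => iffT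

/-! ### Inference rules for forced truth values -/

section rules
variable {v w : World Γ₀} {p q r : Truth Γ₀} {P : ℕ → Truth Γ₀}

theorem Forces.mp (h : v ⊩ p →ₜ q) (hp : w ⊩ p) (hw : v ≤ w := by order) : w ⊩ q :=
  h w hw hp

theorem Forces.inl (h : w ⊩ p) : w ⊩ p ∨ₜ q := fun _ hv _ k => k _ le_rfl (.inl h.up)

theorem Forces.inr (h : w ⊩ q) : w ⊩ p ∨ₜ q := fun _ hv _ k => k _ le_rfl (.inr h.up)

/-- Locality of `r` is what allows a case distinction that is available only on a cover; likewise in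
`Forces.elim`. -/
theorem Forces.cases (h : w ⊩ p ∨ₜ q) (h₁ : ∀ v, w ≤ v → (v ⊩ p) → (v ⊩ r))
    (h₂ : ∀ v, w ≤ v → (v ⊩ q) → (v ⊩ r)) : w ⊩ r :=
  r.loc fun v hv ψ k => h v hv ψ fun u hu hpq =>
    k u hu (hpq.elim (h₁ u (hv.trans hu)) (h₂ u (hv.trans hu)))

theorem Forces.intro (t : ℕ) (h : w ⊩ P t) : w ⊩ exT P := fun _ hv _ k => k _ le_rfl ⟨t, h.up⟩

theorem Forces.elim (h : w ⊩ exT P) (k : ∀ v, w ≤ v → ∀ t, (v ⊩ P t) → (v ⊩ r)) : w ⊩ r :=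
  r.loc fun v hv ψ k' => h v hv ψ fun u hu ⟨t, ht⟩ => k' u hu (k u (hv.trans hu) t ht)

theorem Forces.mp_iff (h : v ⊩ p ↔ₜ q) (hp : w ⊩ p) (hw : v ≤ w := by order) : w ⊩ q :=
  h.1 w hw hp

theorem Forces.mpr_iff (h : v ⊩ p ↔ₜ q) (hp : w ⊩ q) (hw : v ≤ w := by order) : w ⊩ p :=
  h.2 w hw hp

end rules

/-! ## Truth values of formulas -/

/-- The truth value of a formula under a renaming of its free variables. -/
def sat : Fm → (ℕ → ℕ) → Truth Γ₀
  | .mem i j, ρ => provT (.mem (ρ i) (ρ j))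
  | .eq i j, ρ => provT (.eq (ρ i) (ρ j))
  | .bot, _ => botT
  | .and φ ψ, ρ => sat φ ρ ∧ₜ sat ψ ρ
  | .or φ ψ, ρ => sat φ ρ ∨ₜ sat ψ ρ
  | .imp φ ψ, ρ => sat φ ρ →ₜ sat ψ ρ
  | .all φ, ρ => allT fun t => sat φ (scons t ρ)
  | .ex φ, ρ => exT fun t => sat φ (scons t ρ)

/-- Soundness and completeness at once, by induction on `φ`. Implication passes to the context
extended by its premise; disjunction and existence unfold the coverage, whose defining property is
exactly their elimination rule; quantifiers use fresh variables. -/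
theorem forces_sat {φ : Fm} : ∀ {ρ : ℕ → ℕ} {w : World Γ₀},
    (w ⊩ sat φ ρ) ↔ w.Proves (φ.ren ρ) := by
  induction φ with
  | mem i j => exact Iff.rfl
  | eq i j => exact Iff.rfl
  | bot =>
    exact ⟨fun h => h _ le_rfl _ fun _ _ hf => hf.elim, fun h v hv ψ _ => .botE (h.mono hv)⟩
  | and φ ψ h₁ h₂ =>
    exact ⟨fun h => .andI (h₁.1 h.1) (h₂.1 h.2), fun h => ⟨h₁.2 (.andE₁ h), h₂.2 (.andE₂ h)⟩⟩
  | or φ ψ h₁ h₂ =>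
    intro ρ w
    refine ⟨fun h => h _ le_rfl _ fun u _ hu => hu.elim (fun h => .orI₁ (h₁.1 h))
      fun h => .orI₂ (h₂.1 h), fun h v hv χ k => ?_⟩
    exact .orE (h.mono hv)
      (k (v.cons _) (v.le_cons _) (.inl (h₁.2 (v.cons_proves _))))
      (k (v.cons _) (v.le_cons _) (.inr (h₂.2 (v.cons_proves _))))
  | imp φ ψ h₁ h₂ =>
    intro ρ w
    exact ⟨fun h => .impI (h₂.1 (h (w.cons _) (w.le_cons _) (h₁.2 (w.cons_proves _)))),
      fun h v hv hφ => h₂.2 (.impE (h.mono hv) (h₁.1 hφ))⟩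
  | all φ ih =>
    intro ρ w
    refine ⟨fun h => Prf.all_of_forall fun t => ?_, fun h t => ih.2 ?_⟩
    · rw [Fm.ren_up_inst]; exact ih.1 (h t)
    · rw [← Fm.ren_up_inst]; exact .allE t h
  | ex φ ih =>
    intro ρ w
    refine ⟨fun h => h _ le_rfl _ fun u _ ⟨t, ht⟩ => .exI t ?_, fun h v hv ψ k => ?_⟩
    · rw [Fm.ren_up_inst]; exact ih.1 ht
    · refine Prf.ex_elim (h.mono hv) fun t => k (v.cons _) (v.le_cons _) ⟨t, ih.2 ?_⟩
      rw [← Fm.ren_up_inst]; exact v.cons_proves _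

theorem sat_ren (φ : Fm) (f ρ : ℕ → ℕ) : (sat (φ.ren f) ρ : Truth Γ₀) = sat φ (ρ ∘ f) := by
  ext w
  change (w ⊩ _) ↔ (w ⊩ _)
  rw [forces_sat, forces_sat, Fm.ren_ren]

theorem forces_sat_id {φ : Fm} {w : World Γ₀} : (w ⊩ sat φ id) ↔ w.Proves φ := by
  rw [forces_sat, Fm.ren_id]

theorem forces_axiom {φ : Fm} (h : CZFMinus φ) (w : World Γ₀) : w ⊩ sat φ id :=
  forces_sat_id.2 (.ax h)

/-! ## Truth values of set-theoretic notions -/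

def memT (a b : ℕ) : Truth Γ₀ := provT (.mem a b)
def eqT (a b : ℕ) : Truth Γ₀ := provT (.eq a b)

/-- The class with parameters given by a formula. -/
def extT (φ : Fm) : ℕ → Truth Γ₀ := fun a => sat φ (scons a id)

def subT (X Y : ℕ → Truth Γ₀) : Truth Γ₀ := allT fun x => X x →ₜ Y x

def eqCT (X Y : ℕ → Truth Γ₀) : Truth Γ₀ := allT fun x => X x ↔ₜ Y x

/-- The class of the elements of a set. -/
def elT (a : ℕ) : ℕ → Truth Γ₀ := fun x => memT x a

def isUnordPairT (z x y : ℕ) : Truth Γ₀ := allT fun w => memT w z ↔ₜ eqT w x ∨ₜ eqT w y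

def isPairT (z x y : ℕ) : Truth Γ₀ :=
  allT fun w => memT w z ↔ₜ isUnordPairT w x x ∨ₜ isUnordPairT w x y

def pairInT (R : ℕ → Truth Γ₀) (x y : ℕ) : Truth Γ₀ := exT fun z => isPairT z x y ∧ₜ R z

def subProdT (R X Y : ℕ → Truth Γ₀) : Truth Γ₀ :=
  allT fun z => R z →ₜ exT fun x => X x ∧ₜ exT fun y => Y y ∧ₜ isPairT z x y

section notions
variable (L Le : ℕ → Truth Γ₀) (B : ℕ) (Φ : ℕ → Truth Γ₀)

def isPoclassT : Truth Γ₀ :=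
  (allT fun x => L x →ₜ pairInT Le x x) ∧ₜ
  (allT fun x => L x →ₜ allT fun y => L y →ₜ allT fun z => L z →ₜ
    pairInT Le x y →ₜ pairInT Le y z →ₜ pairInT Le x z) ∧ₜ
  (allT fun x => L x →ₜ allT fun y => L y →ₜ pairInT Le x y →ₜ pairInT Le y x →ₜ eqT x y)

def isSupT (U s : ℕ) : Truth Γ₀ :=
  L s ∧ₜ (allT fun x => memT x U →ₜ pairInT Le x s) ∧ₜ
  (allT fun t => L t →ₜ (allT fun x => memT x U →ₜ pairInT Le x t) →ₜ pairInT Le s t)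

def isJoinSemilatticeT : Truth Γ₀ :=
  isPoclassT L Le ∧ₜ allT fun U => subT (elT U) L →ₜ exT fun s => isSupT L Le U s

def downT (x : ℕ) : ℕ → Truth Γ₀ := fun b => memT b B ∧ₜ pairInT Le b x

def isGeneratingT : Truth Γ₀ :=
  subT (elT B) L ∧ₜ
  allT fun x => L x →ₜ exT fun D => eqCT (elT D) (downT Le B x) ∧ₜ isSupT L Le D x

def isAbstractInductiveDefinitionT : Truth Γ₀ :=
  isJoinSemilatticeT L Le ∧ₜ isGeneratingT L Le B ∧ₜ subProdT Φ (elT B) L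

def isCLClosedT (Y : ℕ → Truth Γ₀) : Truth Γ₀ :=
  allT fun U => subT (elT U) Y →ₜ allT fun s => isSupT L Le U s →ₜ subT (downT Le B s) Y

def isPhiClosedT (Y : ℕ → Truth Γ₀) : Truth Γ₀ :=
  subT Y (elT B) ∧ₜ isCLClosedT L Le B Y ∧ₜ
  allT fun b => allT fun a => pairInT Φ b a →ₜ subT (downT Le B a) Y →ₜ Y b

def cLT (Y : ℕ → Truth Γ₀) : ℕ → Truth Γ₀ := fun b =>
  memT b B ∧ₜ exT fun U => subT (elT U) (elT B) ∧ₜ subT (elT U) Y ∧ₜ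
    exT fun s => isSupT L Le U s ∧ₜ downT Le B s b

def gammaT (Y : ℕ → Truth Γ₀) : ℕ → Truth Γ₀ := fun b =>
  memT b B ∧ₜ exT fun a => pairInT Φ b a ∧ₜ subT (downT Le B a) Y

def stageT (J : ℕ → Truth Γ₀) (α : ℕ) : ℕ → Truth Γ₀ := fun y => memT y B ∧ₜ pairInT J α y

def stageBelowT (J : ℕ → Truth Γ₀) (α : ℕ) : ℕ → Truth Γ₀ := fun y =>
  memT y B ∧ₜ exT fun β => memT β α ∧ₜ pairInT J β y

def stageInftyT (J : ℕ → Truth Γ₀) : ℕ → Truth Γ₀ := fun y =>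
  memT y B ∧ₜ exT fun α => pairInT J α y

def isIterationT (J : ℕ → Truth Γ₀) : Truth Γ₀ :=
  subProdT J (fun x => eqT x x) (elT B) ∧ₜ
  allT fun α => eqCT (cLT L Le B (stageT B J α))
    (cLT L Le B (gammaT Le B Φ (cLT L Le B (stageBelowT B J α))))

/-- The set `G` of pairs is justified: if `(α, b) ∈ G`, then some `(b, a) ∈ Φ` has
`↓a ⊆ c_L G^{∈α}`. -/
def goodT (G : ℕ) : Truth Γ₀ := allT fun z => memT z G →ₜ exT fun α => exT fun b =>
  memT b B ∧ₜ isPairT z α b ∧ₜ exT fun a => pairInT Φ b a ∧ₜ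
    subT (downT Le B a) (cLT L Le B (stageBelowT B (elT G) α))

/-- The union of the justified sets. -/
def goodUnionT : ℕ → Truth Γ₀ := fun z => exT fun G => goodT L Le B Φ G ∧ₜ memT z G

end notions

/-- The formula that a set `G` is justified; see `goodT`. -/
def isGood (L Le : Cls) (B : Var) (Φ : Cls) (G : Var) : Fml :=
  allIn (ofSet G) fun z => exV fun α => exV fun b =>
    b ∈ₛ B ∧ₛ isPair z α b ∧ₛ exV fun a => pairIn Φ b a ∧ₛ
      subC (down Le B a) (cL L Le B (stageBelow B (ofSet G) α))

/-- The union of the justified sets; see `goodUnionT`. -/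
def goodUnion (L Le : Cls) (B : Var) (Φ : Cls) : Cls := fun z =>
  exV fun G => isGood L Le B Φ G ∧ₛ z ∈ₛ G

/-! ## Evaluation of formulas -/

/-- The variable that has index `i` at depth `k`. -/
def lev (k i : ℕ) : Var := fun m => m - (k - i)

section
variable (ρ : ℕ → ℕ) (k : ℕ)

theorem sat_cls (φ : Fm) (x : Var) :
    (sat (cls φ x k) ρ : Truth Γ₀) = sat φ (scons (ρ (x k)) fun n => ρ (n + k)) := by
  rw [cls, sat_ren]
  congr 1; funext n; cases n <;> rfl

theorem sat_rel (φ : Fm) (x y : Var) : (sat (rel φ x y k) ρ : Truth Γ₀) =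
    sat φ (scons (ρ (x k)) (scons (ρ (y k)) fun n => ρ (n + k))) := by
  rw [rel, sat_ren]
  congr 1; funext n; rcases n with _ | _ | n <;> rfl

theorem sat_memV (x y : Var) : (sat ((x ∈ₛ y) k) ρ : Truth Γ₀) = memT (ρ (x k)) (ρ (y k)) := rfl
theorem sat_eqV (x y : Var) : (sat ((x =ₛ y) k) ρ : Truth Γ₀) = eqT (ρ (x k)) (ρ (y k)) := rfl
theorem sat_andF (φ ψ : Fml) :
    (sat ((φ ∧ₛ ψ) k) ρ : Truth Γ₀) = (sat (φ k) ρ ∧ₜ sat (ψ k) ρ) := rfl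
theorem sat_orF (φ ψ : Fml) :
    (sat ((φ ∨ₛ ψ) k) ρ : Truth Γ₀) = (sat (φ k) ρ ∨ₜ sat (ψ k) ρ) := rfl
theorem sat_impF (φ ψ : Fml) :
    (sat ((φ →ₛ ψ) k) ρ : Truth Γ₀) = (sat (φ k) ρ →ₜ sat (ψ k) ρ) := rfl
theorem sat_iffF (φ ψ : Fml) :
    (sat ((φ ↔ₛ ψ) k) ρ : Truth Γ₀) = (sat (φ k) ρ ↔ₜ sat (ψ k) ρ) := rfl
theorem sat_allV (φ : Var → Fml) : (sat (allV φ k) ρ : Truth Γ₀) =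
    allT fun t => sat (φ (lev (k + 1) 0) (k + 1)) (scons t ρ) := rfl
theorem sat_exV (φ : Var → Fml) : (sat (exV φ k) ρ : Truth Γ₀) =
    exT fun t => sat (φ (lev (k + 1) 0) (k + 1)) (scons t ρ) := rfl


end

section evaluation
attribute [local simp] Function.id_def sat_cls sat_rel sat_memV sat_eqV sat_andF sat_orF sat_impF
  sat_iffF sat_allV sat_exV lev param allIn exIn ofSet subC eqC isUnordPair isPair pairIn subProd
  univC isPoclass isSup isJoinSemilattice down isGenerating isAbstractInductiveDefinition isCLClosed
  isPhiClosed cL gammaBar stage stageBelow stageInfty isIteration isGood goodUnion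
  isUnordPairT isPairT pairInT subT eqCT subProdT elT extT
  isPoclassT isSupT isJoinSemilatticeT downT isGeneratingT isAbstractInductiveDefinitionT
  isCLClosedT isPhiClosedT cLT gammaT stageT stageBelowT stageInftyT isIterationT goodT goodUnionT

section
variable {L Le Φ J C : Fm} {B : ℕ} {w : World Γ₀}

theorem sat_isAbstractInductiveDefinition :
    (sat (isAbstractInductiveDefinition (cls L) (cls Le) (param B) (cls Φ) 0) id : Truth Γ₀) =
      isAbstractInductiveDefinitionT (extT L) (extT Le) B (extT Φ) := by
  simp

theorem sat_isIteration :
    (sat (isIteration (cls L) (cls Le) (param B) (cls Φ) (cls J) 0) id : Truth Γ₀) =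
      isIterationT (extT L) (extT Le) B (extT Φ) (extT J) := by
  simp

theorem sat_isPhiClosed :
    (sat (isPhiClosed (cls L) (cls Le) (param B) (cls Φ) (cls C) 0) id : Truth Γ₀) =
      isPhiClosedT (extT L) (extT Le) B (extT Φ) (extT C) := by
  simp

theorem sat_isPhiClosed_cL :
    (sat (isPhiClosed (cls L) (cls Le) (param B) (cls Φ)
      (cL (cls L) (cls Le) (param B) (stageInfty (param B) (cls J))) 0) id : Truth Γ₀) =
      isPhiClosedT (extT L) (extT Le) B (extT Φ)
        (cLT (extT L) (extT Le) B (stageInftyT B (extT J))) := by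
  simp

theorem sat_subC_cL :
    (sat (subC (cL (cls L) (cls Le) (param B) (stageInfty (param B) (cls J))) (cls C) 0) id :
      Truth Γ₀) = subT (cLT (extT L) (extT Le) B (stageInftyT B (extT J))) (extT C) := by
  simp

/-- The environment of the parameters is arbitrary here because the formula for J is later renamed
to control its free variables. -/
theorem sat_goodUnion (z : ℕ) (ρ : ℕ → ℕ) :
    (sat (goodUnion (cls L) (cls Le) (param B) (cls Φ) (lev 1 0) 1) (scons z ρ) : Truth Γ₀) =
      goodUnionT (fun a => sat L (scons a ρ)) (fun a => sat Le (scons a ρ)) (ρ B)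
        (fun a => sat Φ (scons a ρ)) z := by
  simp

/-! ## Definable classes and the axioms -/

/-- The class is given by a formula. -/
def Def₁ (P : ℕ → Truth Γ₀) : Prop := ∃ φ : Fm, ∀ x, sat φ (scons x id) = P x

/-- The binary relation is given by a formula. -/
def Def₂ (R : ℕ → ℕ → Truth Γ₀) : Prop := ∃ φ : Fm, ∀ x y, sat φ (scons x (scons y id)) = R x y

/-- Individuals are variables, so an individual `a` can occur in `K` as the parameter `param a`. -/
theorem Def₁.of_cls {P : ℕ → Truth Γ₀} (K : Cls) (h : ∀ x, sat (K (lev 1 0) 1) (scons x id) = P x) :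
    Def₁ P := ⟨_, h⟩

theorem Def₂.of_rel {R : ℕ → ℕ → Truth Γ₀} (K : Var → Var → Fml)
    (h : ∀ x y, sat (K (lev 2 0) (lev 2 1) 2) (scons x (scons y id)) = R x y) : Def₂ R := ⟨_, h⟩

theorem eqT_refl (a : ℕ) : w ⊩ eqT a a := .eqI a

theorem Forces.subst {P : ℕ → Truth Γ₀} (hP : Def₁ P) {a b : ℕ} (h : w ⊩ eqT a b) (ha : w ⊩ P a) :
    w ⊩ P b := by
  obtain ⟨φ, hφ⟩ := hP
  have key : ∀ t, φ.inst t = φ.ren (scons t id) := fun t => by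
    rw [Fm.inst]; congr 1
  rw [← hφ, forces_sat, ← key] at *
  exact .eqE φ h ha

theorem extensionality {a b : ℕ} (h : w ⊩ allT fun y => memT y a ↔ₜ memT y b) : w ⊩ eqT a b := by
  have := forces_axiom .extensionality w
  simp at this
  exact (this a b).mp h

theorem exists_unordPair (a b : ℕ) : w ⊩ exT fun z => isUnordPairT z a b := by
  have := forces_axiom .pair w
  simp at this
  exact this a b

theorem exists_union (a : ℕ) :
    w ⊩ exT fun x => allT fun y => memT y x ↔ₜ exT fun z => memT z a ∧ₜ memT y z := by
  have := forces_axiom .union w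
  simp at this
  exact this a

theorem collection {R : ℕ → ℕ → Truth Γ₀} (hR : Def₂ R) {a : ℕ}
    (h : w ⊩ allT fun x => memT x a →ₜ exT fun y => R x y) :
    w ⊩ exT fun b => (allT fun x => memT x a →ₜ exT fun y => memT y b ∧ₜ R x y) ∧ₜ
      (allT fun y => memT y b →ₜ exT fun x => memT x a ∧ₜ R x y) := by
  obtain ⟨φ, hφ⟩ := hR
  have := forces_axiom (.strongCollection φ) w
  simp at this
  simp at hφ
  simp only [hφ] at this
  exact (this a).mp h

theorem induction {P : ℕ → Truth Γ₀} (hP : Def₁ P)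
    (h : ∀ v, w ≤ v → ∀ a, (v ⊩ allT fun x => memT x a →ₜ P x) → (v ⊩ P a)) (a : ℕ) : w ⊩ P a := by
  obtain ⟨φ, hφ⟩ := hP
  have := forces_axiom (.setInduction φ) w
  simp at this
  simp at hφ
  simp only [hφ] at this
  exact this.mp (fun a v hv => h v hv a) le_rfl a

end

section
variable {w : World Γ₀} {a b c x y z s t x' y' : ℕ}

/-! ## Equality and pairs -/

theorem eqT_symm (h : w ⊩ eqT a b) : w ⊩ eqT b a :=
  h.subst (P := fun t => eqT t a) (.of_cls (fun t => t =ₛ param a) (by simp)) (eqT_refl a)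

theorem eqT_trans (h : w ⊩ eqT a b) (h' : w ⊩ eqT b c) : w ⊩ eqT a c :=
  h'.subst (P := fun t => eqT a t) (.of_cls (fun t => param a =ₛ t) (by simp)) h

theorem isUnordPairT_left (h : w ⊩ isUnordPairT z x y) : w ⊩ memT x z :=
  (h x).mpr_iff (eqT_refl x).inl

theorem isUnordPairT_right (h : w ⊩ isUnordPairT z x y) : w ⊩ memT y z :=
  (h y).mpr_iff (eqT_refl y).inr

theorem isUnordPairT_unique (h : w ⊩ isUnordPairT s x y) (h' : w ⊩ isUnordPairT t x y) :
    w ⊩ eqT s t :=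
  extensionality fun u => ⟨fun _ _ hu => (h' u).mpr_iff ((h u).mp_iff hu),
    fun _ _ hu => (h u).mpr_iff ((h' u).mp_iff hu)⟩

/-- The singleton {x} belongs to z, so it is {x'} or {x', y'}; either way x' ∈ {x}. -/
theorem isPairT_fst (h : w ⊩ isPairT z x y) (h' : w ⊩ isPairT z x' y') : w ⊩ eqT x' x := by
  refine (exists_unordPair x x).elim fun v hv s hs => ?_
  have : v ⊩ memT x' s := ((h' s).mp_iff ((h s).mpr_iff hs.inl)).cases
    (fun _ _ k => isUnordPairT_left k) fun _ _ k => isUnordPairT_left k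
  exact ((hs x').mp_iff this).cases (fun _ _ k => k) fun _ _ k => k

theorem isPairT_snd_or (h : w ⊩ isPairT z x y) (h' : w ⊩ isPairT z x' y') :
    w ⊩ eqT y' x ∨ₜ eqT y' y := by
  refine (exists_unordPair x' y').elim fun v hv s hs => ?_
  refine ((h s).mp_iff ((h' s).mpr_iff hs.inr)).cases (fun u hu k => ?_) fun u hu k => ?_
  · exact ((k y').mp_iff (isUnordPairT_right hs.up)).cases (fun _ _ e => e.inl) fun _ _ e => e.inl
  · exact (k y').mp_iff (isUnordPairT_right hs.up)

/-- Deciding whether x = y is avoided intuitionistically: by symmetry y' is x or y, and y is x' or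
y'. In the one case left, y' = x = x' = y. -/
theorem isPairT_snd (h : w ⊩ isPairT z x y) (h' : w ⊩ isPairT z x' y') : w ⊩ eqT y' y := by
  refine (isPairT_snd_or h h').cases (fun v hv e => ?_) fun _ _ e => e
  refine (isPairT_snd_or h' h).up.cases (fun u hu e' => ?_) fun _ _ e' => eqT_symm e'
  exact eqT_trans (eqT_trans e.up (eqT_symm (isPairT_fst h.up h'.up))) (eqT_symm e')

theorem exists_pair (x y : ℕ) : w ⊩ exT fun z => isPairT z x y := by
  refine (exists_unordPair x x).elim fun v₁ h₁ s hs => ?_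
  refine (exists_unordPair x y).elim fun v₂ h₂ t ht => ?_
  refine (exists_unordPair s t).elim fun v₃ h₃ z hz => .intro z fun u => ⟨fun _ _ hu => ?_,
    fun _ _ hu => ?_⟩
  · refine ((hz u).mp_iff hu).cases (fun _ _ e => ?_) fun _ _ e => ?_
    · exact .inl ((eqT_symm e).subst (P := fun t => isUnordPairT t x x)
        (.of_cls (fun t => isUnordPair t (param x) (param x)) (by simp)) hs.up)
    · exact .inr ((eqT_symm e).subst (P := fun t => isUnordPairT t x y)
        (.of_cls (fun t => isUnordPair t (param x) (param y)) (by simp)) ht.up)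
  · refine hu.cases (fun _ _ e => ?_) fun _ _ e => ?_
    · exact (hz u).mpr_iff (isUnordPairT_unique e hs.up).inl
    · exact (hz u).mpr_iff (isUnordPairT_unique e ht.up).inr

/-- The set is ⋃{a, {z}}. -/
theorem exists_insert (a z : ℕ) : w ⊩ exT fun b => allT fun y => memT y b ↔ₜ memT y a ∨ₜ eqT y z := by
  refine (exists_unordPair z z).elim fun v₁ h₁ s hs => ?_
  refine (exists_unordPair a s).elim fun v₂ h₂ p hp => ?_
  refine (exists_union p).elim fun v₃ h₃ b hb => .intro b fun y => ⟨fun _ _ hy => ?_,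
    fun _ _ hy => ?_⟩
  · refine ((hb y).mp_iff hy).elim fun _ _ c hc => ?_
    refine ((hp c).mp_iff hc.1).cases (fun _ _ e => .inl ?_) fun _ _ e => .inr ?_
    · exact e.subst (P := fun t => memT y t) (.of_cls (fun t => param y ∈ₛ t) (by simp)) hc.2.up
    · have := e.subst (P := fun t => memT y t) (.of_cls (fun t => param y ∈ₛ t) (by simp)) hc.2.up
      exact ((hs y).mp_iff this).cases (fun _ _ e => e) fun _ _ e => e
  · refine hy.cases (fun _ _ k => ?_) fun _ _ k => ?_
    · exact (hb y).mpr_iff (.intro a ⟨isUnordPairT_left hp.up, k⟩)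
    · exact (hb y).mpr_iff (.intro s ⟨isUnordPairT_right hp.up, (hs y).mpr_iff k.inl⟩)

/-! ## Closures and covers -/

variable {X Y L' Le' : ℕ → Truth Γ₀} {J : ℕ → Truth Γ₀} {L Le Φ : Fm} {B D U α : ℕ}

theorem pairInT_mono (h : w ⊩ subT X Y) (hx : w ⊩ pairInT X x y) : w ⊩ pairInT Y x y :=
  hx.elim fun _ _ z hz => .intro z ⟨hz.1, (h z).mp hz.2⟩

theorem cLT_mono (h : w ⊩ subT X Y) : w ⊩ subT (cLT L' Le' B X) (cLT L' Le' B Y) :=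
  fun _ _ _ hb => ⟨hb.1, hb.2.elim fun _ _ U hU => .intro U
    ⟨hU.1, fun y _ _ hy => (h y).mp ((hU.2.1 y).mp hy), hU.2.2⟩⟩

theorem stageBelowT_mono (h : w ⊩ subT X Y) : w ⊩ subT (stageBelowT B X α) (stageBelowT B Y α) :=
  fun _ _ _ hy => ⟨hy.1, hy.2.elim fun _ _ β hβ => .intro β ⟨hβ.1, pairInT_mono h.up hβ.2⟩⟩

theorem goodT_mono_stage {G H : ℕ} (h : w ⊩ subT (elT G) (elT H))
    (hG : w ⊩ subT (downT Le' B a) (cLT L' Le' B (stageBelowT B (elT G) α))) :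
    w ⊩ subT (downT Le' B a) (cLT L' Le' B (stageBelowT B (elT H) α)) :=
  fun d _ _ hd => (cLT_mono (stageBelowT_mono h) d).mp ((hG d).mp hd)

/-- The witnesses stored in G for the pair equal α and b by injectivity of pairing. The justifying
cover passes from G to the union because G is itself one of the justified sets. -/
theorem goodT_stage (h : w ⊩ pairInT (goodUnionT (extT L) (extT Le) B (extT Φ)) α b) :
    w ⊩ gammaT (extT Le) B (extT Φ) (cLT (extT L) (extT Le) B
      (stageBelowT B (goodUnionT (extT L) (extT Le) B (extT Φ)) α)) b := by
  refine h.elim fun v₁ h₁ z hz => hz.2.elim fun v₂ h₂ G hG => ?_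
  refine ((hG.1 z).mp hG.2).elim fun v₃ h₃ α' hα => hα.elim fun v₄ h₄ b' hb => ?_
  have e₁ : v₄ ⊩ eqT α' α := isPairT_fst hz.1.up hb.2.1
  have e₂ : v₄ ⊩ eqT b' b := isPairT_snd hz.1.up hb.2.1
  refine ⟨e₂.subst (P := fun t => memT t B) (.of_cls (fun t => t ∈ₛ param B) (by simp)) hb.1, ?_⟩
  refine hb.2.2.elim fun v₅ h₅ a ha => .intro a ⟨?_, ?_⟩
  · exact e₂.up.subst (P := fun t => pairInT (extT Φ) t a)
      (.of_cls (fun t => pairIn (cls Φ) t (param a)) (by simp)) ha.1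
  · have hG' : v₅ ⊩ subT (elT G) (goodUnionT (extT L) (extT Le) B (extT Φ)) :=
      fun z _ _ hz => .intro G ⟨hG.1.up, hz⟩
    have := e₁.up.subst
      (P := fun t => subT (downT (extT Le) B a)
        (cLT (extT L) (extT Le) B (stageBelowT B (elT G) t)))
      (.of_cls (fun t => subC (down (cls Le) (param B) (param a))
        (cL (cls L) (cls Le) (param B) (stageBelow (param B) (ofSet (param G)) t))) (by simp)) ha.2
    exact fun d _ _ hd => (cLT_mono (stageBelowT_mono hG') d).mp ((this d).mp hd)

/-- A union of justified sets is justified. -/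
theorem goodT_union {S G : ℕ} (hS : w ⊩ allT fun g => memT g S →ₜ goodT L' Le' B Y g)
    (hG : w ⊩ allT fun y => memT y G ↔ₜ exT fun z => memT z S ∧ₜ memT y z) :
    w ⊩ goodT L' Le' B Y G := by
  intro z v hv hz
  refine ((hG z).mp_iff hz).elim fun v₁ h₁ g hg => ?_
  refine (((hS g).mp hg.1 : v₁ ⊩ goodT L' Le' B Y g) z).mp hg.2 |>.elim fun v₂ h₂ α hα => .intro α ?_
  refine hα.elim fun v₃ h₃ b hb => .intro b ⟨hb.1, hb.2.1, ?_⟩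
  refine hb.2.2.elim fun v₄ h₄ a ha => .intro a ⟨ha.1, ?_⟩
  exact goodT_mono_stage (fun y _ _ hy => (hG y).mpr_iff (.intro g ⟨hg.1.up, hy⟩)) ha.2

/-- Adding a pair that is justified by a justified set gives a justified set. -/
theorem goodT_insert {G H : ℕ} (hG : w ⊩ goodT (extT L) (extT Le) B (extT Φ) G)
    (hH : w ⊩ allT fun y => memT y H ↔ₜ memT y G ∨ₜ eqT y z) (hz : w ⊩ isPairT z α b)
    (hb : w ⊩ memT b B) (ha : w ⊩ pairInT (extT Φ) b a)
    (h : w ⊩ subT (downT (extT Le) B a)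
      (cLT (extT L) (extT Le) B (stageBelowT B (elT G) α))) :
    w ⊩ goodT (extT L) (extT Le) B (extT Φ) H := by
  have hGH : w ⊩ subT (elT G) (elT H) := fun y _ _ hy => (hH y).mpr_iff hy.inl
  intro y v hv hy
  refine ((hH y).mp_iff hy).cases (fun v₁ h₁ k => ?_) fun v₁ h₁ e => ?_
  · refine ((hG y).mp k).elim fun v₂ h₂ α hα => .intro α ?_
    refine hα.elim fun v₃ h₃ b hb => .intro b ⟨hb.1, hb.2.1, ?_⟩
    exact hb.2.2.elim fun v₄ h₄ a ha => .intro a ⟨ha.1, goodT_mono_stage hGH.up ha.2⟩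
  · refine .intro α (.intro b ⟨hb.up, ?_, .intro a ⟨ha.up, goodT_mono_stage hGH.up h.up⟩⟩)
    exact (eqT_symm e).subst (P := fun t => isPairT t α b)
      (.of_cls (fun t => isPair t (param α) (param b)) (by simp)) hz.up

end

section

/-- `Φ` is an abstract inductive definition on `L`, at every context. -/
def ForcesAID (Γ₀ : List Fm) (L Le : Fm) (B : ℕ) (Φ : Fm) : Prop :=
  ∀ w : World Γ₀, w ⊩ isAbstractInductiveDefinitionT (extT L) (extT Le) B (extT Φ)

variable {L Le Φ J : Fm} {B : ℕ} {w : World Γ₀} {Y : ℕ → Truth Γ₀} {D U s a b x y z α : ℕ}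

/-! ## Semilattices -/

theorem ForcesAID.le_trans (H : ForcesAID Γ₀ L Le B Φ) (hx : w ⊩ extT L x) (hy : w ⊩ extT L y)
    (hz : w ⊩ extT L z) (hxy : w ⊩ pairInT (extT Le) x y) (hyz : w ⊩ pairInT (extT Le) y z) :
    w ⊩ pairInT (extT Le) x z := by
  have h := (H w).1.1.2.1
  have h₁ : w ⊩ _ := (h x).mp hx
  have h₂ : w ⊩ _ := (h₁ y).mp hy
  have h₃ : w ⊩ _ := (h₂ z).mp hz
  exact Forces.mp (Forces.mp h₃ hxy) hyz

theorem ForcesAID.mem_L (H : ForcesAID Γ₀ L Le B Φ) (hb : w ⊩ memT b B) : w ⊩ extT L b :=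
  ((H w).2.1.1 b).mp hb

theorem ForcesAID.exists_sup (H : ForcesAID Γ₀ L Le B Φ) (hU : w ⊩ subT (elT U) (elT B)) :
    w ⊩ exT fun s => isSupT (extT L) (extT Le) U s :=
  ((H w).1.2 U).mp fun x _ _ hx => H.mem_L ((hU x).mp hx)

theorem ForcesAID.mem_of_pairInT (H : ForcesAID Γ₀ L Le B Φ) (h : w ⊩ pairInT (extT Φ) b a) :
    w ⊩ memT b B ∧ₜ extT L a := by
  refine h.elim fun v₁ h₁ z hz => (((H v₁).2.2 z).mp hz.2).elim fun v₂ h₂ x hx => ?_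
  refine hx.2.elim fun v₃ h₃ y hy => ⟨?_, ?_⟩
  · exact (isPairT_fst hz.1.up hy.2).subst (P := fun t => memT t B)
      (.of_cls (fun t => t ∈ₛ param B) (by simp)) hx.1.up
  · exact (isPairT_snd hz.1.up hy.2).subst (P := extT L) ⟨L, fun _ => rfl⟩ hy.1

theorem ForcesAID.exists_down (H : ForcesAID Γ₀ L Le B Φ) (h : w ⊩ extT L a) :
    w ⊩ exT fun D => eqCT (elT D) (downT (extT Le) B a) :=
  (((H w).2.1.2 a).mp h).elim fun _ _ D hD => .intro D hD.1

/-- A set covered by a class `Y` is covered by a subset of `Y`. -/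
theorem ForcesAID.cover (H : ForcesAID Γ₀ L Le B Φ) (hY : Def₁ Y)
    (h : w ⊩ subT (elT D) (cLT (extT L) (extT Le) B Y)) :
    w ⊩ exT fun W => subT (elT W) (elT B) ∧ₜ subT (elT W) Y ∧ₜ
      exT fun s => isSupT (extT L) (extT Le) W s ∧ₜ
        allT fun d => memT d D →ₜ pairInT (extT Le) d s := by
  obtain ⟨φ, hφ⟩ := hY
  obtain rfl : extT φ = Y := funext hφ
  -- Choose covers of the elements of `D` by collection. The second half of Strong Collection keeps
  -- the union of the collected sets inside `B` and `Y`; the first half makes it cover all of `D`.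
  have hc := collection (R := fun d W => subT (elT W) (elT B) ∧ₜ subT (elT W) (extT φ) ∧ₜ
    exT fun s => isSupT (extT L) (extT Le) W s ∧ₜ downT (extT Le) B s d)
    (.of_rel (fun d W => subC (ofSet W) (ofSet (param B)) ∧ₛ subC (ofSet W) (cls φ) ∧ₛ
      exV fun s => isSup (cls L) (cls Le) W s ∧ₛ down (cls Le) (param B) s d) (by simp))
    (a := D) (w := w) fun d _ _ hd => ((h d).mp hd).2
  refine hc.elim fun v₁ h₁ S hS => ?_
  refine (exists_union S).elim fun v₂ h₂ W hW => ?_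
  have hB : v₂ ⊩ subT (elT W) (elT B) := fun x _ _ hx =>
    ((hW x).mp_iff hx).elim fun _ _ V hV => ((hS.2 V).mp hV.1).elim fun _ _ d hd =>
      (hd.2.1 x).mp hV.2.up
  have hX : v₂ ⊩ subT (elT W) (extT φ) := fun x _ _ hx =>
    ((hW x).mp_iff hx).elim fun _ _ V hV => ((hS.2 V).mp hV.1).elim fun _ _ d hd =>
      (hd.2.2.1 x).mp hV.2.up
  refine (H.exists_sup hB).elim fun v₃ h₃ s hs => .intro W ⟨hB.up, hX.up, .intro s ⟨hs, ?_⟩⟩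
  intro d v₄ h₄ hd
  refine ((hS.1 d).mp hd).elim fun v₅ h₅ V hV => hV.2.2.2.elim fun v₆ h₆ t ht => ?_
  have hts : v₆ ⊩ pairInT (extT Le) t s := by
    have := (ht.1.2.2 s).mp hs.1.up (w := v₆)
    exact this.mp fun x _ _ hx =>
      (hs.2.1 x).mp ((hW x).mpr_iff (.intro V ⟨hV.1.up, hx⟩))
  exact H.le_trans (H.mem_L ht.2.1) ht.1.1 hs.1.up ht.2.2 hts

/-- A set U ⊆ c_L Y is covered by one W ⊆ Y, so ⋁U ≤ ⋁W and everything below ⋁U lies in c_L Y. -/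
theorem ForcesAID.isCLClosed_cL (H : ForcesAID Γ₀ L Le B Φ) (hY : Def₁ Y) :
    w ⊩ isCLClosedT (extT L) (extT Le) B (cLT (extT L) (extT Le) B Y) := by
  intro U v₁ h₁ hU s v₂ h₂ hs b v₃ h₃ hb
  refine (H.cover hY hU).up.elim fun v₄ h₄ W hW => ?_
  refine hW.2.2.elim fun v₅ h₅ t ht => ⟨hb.1.up, .intro W ⟨hW.1.up, hW.2.1.up, .intro t ⟨ht.1,
    hb.1.up, ?_⟩⟩⟩
  have hst : v₅ ⊩ pairInT (extT Le) s t :=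
    Forces.mp ((hs.2.2 t).mp ht.1.1 (w := v₅)) ht.2
  exact H.le_trans (H.mem_L hb.1.up) hs.1.up ht.1.1 hb.2.up hst

/-- The singleton {b} covers b; definability of `Y` transports membership along equality with b. -/
theorem ForcesAID.sub_cL (H : ForcesAID Γ₀ L Le B Φ) (hY : Def₁ Y) (hb : w ⊩ memT b B)
    (h : w ⊩ Y b) : w ⊩ cLT (extT L) (extT Le) B Y b := by
  refine ⟨hb, (exists_unordPair b b).elim fun v₁ h₁ U hU => .intro U ?_⟩
  have hU' : v₁ ⊩ allT fun x => memT x U →ₜ eqT b x := fun x _ _ hx =>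
    ((hU x).mp_iff hx).cases (fun _ _ e => eqT_symm e) fun _ _ e => eqT_symm e
  have hB : v₁ ⊩ subT (elT U) (elT B) := fun x _ _ hx => ((hU' x).mp hx).subst
    (P := fun t => memT t B) (.of_cls (fun t => t ∈ₛ param B) (by simp)) hb.up
  refine ⟨hB, fun x _ _ hx => ((hU' x).mp hx).subst hY h.up, ?_⟩
  exact (H.exists_sup hB).elim fun v₂ h₂ s hs => .intro s
    ⟨hs, hb.up, (hs.2.1 b).mp (isUnordPairT_left hU.up)⟩

/-- A `c_L`-closed class contains the closure of each of its subclasses. -/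
theorem cLT_sub (h : w ⊩ isCLClosedT (extT L) (extT Le) B Y) {X : ℕ → Truth Γ₀}
    (hX : w ⊩ subT X Y) : w ⊩ subT (cLT (extT L) (extT Le) B X) Y := by
  intro b v₁ h₁ hb
  refine hb.2.elim fun v₂ h₂ U hU => hU.2.2.elim fun v₃ h₃ s hs => ?_
  have := (h U).mp (w := v₃) fun x _ _ hx => (hX x).mp ((hU.2.1 x).mp hx)
  have hs' : v₃ ⊩ subT _ _ := (this s).mp hs.1
  exact (hs' b).mp hs.2

/-! ## The iteration -/

/-- `J` defines the union of the justified sets. -/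
def DefinesGood (Γ₀ : List Fm) (L Le : Fm) (B : ℕ) (Φ J : Fm) : Prop :=
  (extT J : ℕ → Truth Γ₀) = goodUnionT (extT L) (extT Le) B (extT Φ)

theorem DefinesGood.stage (hJ : DefinesGood Γ₀ L Le B Φ J) (h : w ⊩ pairInT (extT J) α b) :
    w ⊩ gammaT (extT Le) B (extT Φ) (cLT (extT L) (extT Le) B (stageBelowT B (extT J) α)) b := by
  rw [DefinesGood] at hJ
  rw [hJ] at *
  exact goodT_stage h

/-- If `↓a` is covered by the stages below `α`, it is covered by the stages below `α` of a justified
set. -/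
theorem ForcesAID.exists_good (H : ForcesAID Γ₀ L Le B Φ) (hJ : DefinesGood Γ₀ L Le B Φ J)
    (h : w ⊩ subT (elT D) (cLT (extT L) (extT Le) B (stageBelowT B (extT J) α))) :
    w ⊩ exT fun G => goodT (extT L) (extT Le) B (extT Φ) G ∧ₜ
      subT (elT D) (cLT (extT L) (extT Le) B (stageBelowT B (elT G) α)) := by
  refine (H.cover (.of_cls (stageBelow (param B) (cls J) (param α)) (by simp)) h).elim
    fun v₁ h₁ W hW => hW.2.2.elim fun v₂ h₂ s hs => ?_
  -- Both halves of Strong Collection are needed: one makes every collected set justified, hence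
  -- their union; the other places each `x` of `W` in a stage below `α` of that union.
  have hc := collection (R := fun x G => goodT (extT L) (extT Le) B (extT Φ) G ∧ₜ
      stageBelowT B (elT G) α x)
    (.of_rel (fun x G => isGood (cls L) (cls Le) (param B) (cls Φ) G ∧ₛ
      stageBelow (param B) (ofSet G) (param α) x) (by simp))
    (a := W) (w := v₂) fun x v₃ h₃ hx => by
      have := (hW.2.1 x).mp hx
      rw [hJ] at this
      refine this.2.elim fun v₄ h₄ β hβ => hβ.2.elim fun v₅ h₅ z hz => ?_
      exact hz.2.elim fun v₆ h₆ G hG => .intro G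
        ⟨hG.1, this.1.up, .intro β ⟨hβ.1.up, .intro z ⟨hz.1.up, hG.2⟩⟩⟩
  refine hc.elim fun v₃ h₃ S hS => (exists_union S).elim fun v₄ h₄ G hG => .intro G ⟨?_, ?_⟩
  · exact goodT_union (fun g _ _ hg => ((hS.2 g).mp hg).elim fun _ _ x hx => hx.2.1) hG
  · intro d v₅ h₅ hd
    refine ⟨((h d).mp hd).1, .intro W ⟨hW.1.up, fun x v₆ h₆ hx => ?_, .intro s ⟨hs.1.up,
      ((h d).mp hd).1, (hs.2 d).mp hd⟩⟩⟩
    refine ((hS.1 x).mp hx).elim fun v₇ h₇ g hg => ?_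
    have : v₇ ⊩ subT (elT g) (elT G) := fun y _ _ hy => (hG y).mpr_iff (.intro g ⟨hg.1.up, hy⟩)
    exact (stageBelowT_mono this x).mp hg.2.2

/-- That ↓a is a set reduces the hypothesis to a single justified G with ↓a ⊆ c_L G^{∈α}; then G ∪
{(α, b)} is justified and puts the pair into J. -/
theorem ForcesAID.stage_of_gamma (H : ForcesAID Γ₀ L Le B Φ) (hJ : DefinesGood Γ₀ L Le B Φ J)
    (h : w ⊩ gammaT (extT Le) B (extT Φ)
      (cLT (extT L) (extT Le) B (stageBelowT B (extT J) α)) b) : w ⊩ pairInT (extT J) α b := by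
  rw [DefinesGood] at hJ
  refine h.2.elim fun v₁ h₁ a ha => ?_
  refine (H.exists_down (H.mem_of_pairInT ha.1).2).elim fun v₂ h₂ D hD => ?_
  have hD' : v₂ ⊩ subT (elT D) (cLT (extT L) (extT Le) B (stageBelowT B (extT J) α)) :=
    fun d _ _ hd => (ha.2 d).mp ((hD d).mp_iff hd)
  refine (H.exists_good hJ hD').elim fun v₃ h₃ G hG => ?_
  refine (exists_pair α b).elim fun v₄ h₄ z hz => (exists_insert G z).elim fun v₅ h₅ G' hG' => ?_
  rw [hJ]
  refine .intro z ⟨hz.up, .intro G' ⟨goodT_insert hG.1.up hG' hz.up h.1.up ha.1.up ?_,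
    (hG' z).mpr_iff (eqT_refl z).inr⟩⟩
  exact fun d _ _ hd => (hG.2 d).mp ((hD d).mpr_iff hd)

theorem ForcesAID.isIteration (H : ForcesAID Γ₀ L Le B Φ) (hJ : DefinesGood Γ₀ L Le B Φ J) :
    w ⊩ isIterationT (extT L) (extT Le) B (extT Φ) (extT J) := by
  -- The recursion equation without the outer c_L; the required equation follows by monotonicity of
  -- c_L.
  have hs : ∀ α, w ⊩ eqCT (stageT B (extT J) α)
      (gammaT (extT Le) B (extT Φ) (cLT (extT L) (extT Le) B (stageBelowT B (extT J) α))) :=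
    fun α b => ⟨fun _ _ hb => hJ.stage hb.2, fun _ _ hb => ⟨hb.1, H.stage_of_gamma hJ hb⟩⟩
  refine ⟨fun z v₁ h₁ hz => ?_, fun α b =>
    ⟨cLT_mono (fun y => (hs α y).1) b, cLT_mono (fun y => (hs α y).2) b⟩⟩
  rw [hJ] at hz
  refine hz.elim fun v₂ h₂ G hG => ((hG.1 z).mp hG.2).elim fun v₃ h₃ α hα => ?_
  exact hα.elim fun v₄ h₄ b hb => .intro α ⟨eqT_refl α, .intro b ⟨hb.1, hb.2.1⟩⟩

/-- A cover of ↓a by a subset of J^∞ involves only a set of stages, so it already lies below a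
single stage. -/
theorem ForcesAID.isPhiClosed_cL (H : ForcesAID Γ₀ L Le B Φ) (hJ : DefinesGood Γ₀ L Le B Φ J) :
    w ⊩ isPhiClosedT (extT L) (extT Le) B (extT Φ)
      (cLT (extT L) (extT Le) B (stageInftyT B (extT J))) := by
  have hd : Def₁ (stageInftyT B (extT J) : ℕ → Truth Γ₀) :=
    .of_cls (stageInfty (param B) (cls J)) (by simp)
  refine ⟨fun b _ _ hb => hb.1, H.isCLClosed_cL hd, fun b a v₁ h₁ hba v₂ h₂ ha => ?_⟩
  refine (H.exists_down (H.mem_of_pairInT hba.up).2).elim fun v₃ h₃ D hD => ?_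
  refine (H.cover (D := D) hd fun d _ _ hd => (ha d).mp ((hD d).mp_iff hd)).elim
    fun v₄ h₄ W hW => hW.2.2.elim fun v₅ h₅ s hs => ?_
  -- Every set indexes a stage, so the collected set of stages can serve directly as `α`, with W ⊆
  -- J^{∈α}.
  have hc := collection (R := fun x α => pairInT (extT J) α x)
    (.of_rel (fun x α => pairIn (cls J) α x) (by simp)) (a := W) (w := v₅)
    fun x _ _ hx => ((hW.2.1 x).mp hx).2
  refine hc.elim fun v₆ h₆ α hα => ?_
  have hbB : v₆ ⊩ memT b B := (H.mem_of_pairInT hba.up).1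
  refine H.sub_cL hd hbB ⟨hbB, .intro α (H.stage_of_gamma hJ ⟨hbB, .intro a ⟨hba.up, ?_⟩⟩)⟩
  intro d v₇ h₇ hda
  refine ⟨hda.1, .intro W ⟨hW.1.up, fun x _ _ hx => ⟨(hW.1 x).mp hx, ?_⟩, .intro s ⟨hs.1.up, hda.1,
    (hs.2 d).mp ((hD d).mpr_iff hda)⟩⟩⟩
  exact (hα.1 x).mp hx

/-- Set Induction gives J^α ⊆ C: if J^{∈α} ⊆ C then c_L J^{∈α} ⊆ C by c_L-closure, and Φ-closure
yields the next stage. A last use of c_L-closure passes to c_L J^∞. -/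
theorem DefinesGood.sub_of_isPhiClosed (hJ : DefinesGood Γ₀ L Le B Φ J) {C : Fm}
    (hC : w ⊩ isPhiClosedT (extT L) (extT Le) B (extT Φ) (extT C)) :
    w ⊩ subT (cLT (extT L) (extT Le) B (stageInftyT B (extT J))) (extT C) := by
  refine cLT_sub hC.2.1 fun b v₁ h₁ hb => hb.2.elim fun v₂ h₂ α hα => ?_
  have := induction (P := fun α => allT fun b => pairInT (extT J) α b →ₜ extT C b)
    (.of_cls (fun α => allV fun b => pairIn (cls J) α b →ₛ cls C b) (by simp)) (w := v₂)
    (fun v₃ h₃ α ih b v₄ h₄ hb => ?_) α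
  · exact (this b).mp hα
  · refine (hJ.stage hb).2.elim fun v₅ h₅ a ha => ?_
    have hs : v₅ ⊩ subT (stageBelowT B (extT J) α) (extT C) := fun y v₆ h₆ hy =>
      hy.2.elim fun v₇ h₇ β hβ => by
        have : v₇ ⊩ _ := (ih β).mp hβ.1
        exact (this y).mp hβ.2
    have := (hC.2.2 b a).mp ha.1
    exact Forces.mp this fun d _ _ hd => (cLT_sub hC.2.1.up hs d).mp ((ha.2 d).mp hd)

end

end evaluation

/-! ### The parameters of J and the passage back to derivations -/

theorem exists_definesGood (L Le Φ : Fm) (B : ℕ) : ∃ J : Fm,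
    (∀ n : ℕ, n + 1 ∈ J.fv → n = B ∨ n + 1 ∈ L.fv ∪ Le.fv ∪ Φ.fv) ∧
    ∀ Γ₀ : List Fm, DefinesGood Γ₀ L Le B Φ J := by
  classical
  -- Sending every parameter foreign to `L`, `Le` and `Φ` to `B` forces the free variables to be the
  -- permitted ones without computing those of `goodUnion`. The meaning is unchanged, as `g` fixes
  -- `B` and all parameters of the three classes.
  let g : ℕ → ℕ := fun n => if n + 1 ∈ L.fv ∪ Le.fv ∪ Φ.fv then n else B
  have hg : g B = B := by simp only [g, ite_self]
  refine ⟨(goodUnion (cls L) (cls Le) (param B) (cls Φ) (lev 1 0) 1).ren (up g), fun n hn => ?_,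
    fun Γ₀ => funext fun z => ?_⟩
  · obtain ⟨m, -, hm⟩ := Fm.mem_fv_ren hn
    cases m with
    | zero => cases hm
    | succ m =>
      obtain rfl : g m = n := Nat.succ.inj hm
      by_cases h : m + 1 ∈ L.fv ∪ Le.fv ∪ Φ.fv
      · exact .inr (by simpa only [g, if_pos h] using h)
      · exact .inl (if_neg h)
  · have key : ∀ φ : Fm, (∀ n, n + 1 ∈ φ.fv → n + 1 ∈ L.fv ∪ Le.fv ∪ Φ.fv) →
        (fun a => sat φ (scons a g) : ℕ → Truth Γ₀) = extT φ := fun φ hφ => by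
      funext a
      have h₁ : scons a g = scons a id ∘ up g := by funext n; cases n <;> rfl
      have h₂ : φ.ren (up g) = φ.ren id := Fm.ren_congr fun n hn => by
        cases n with
        | zero => rfl
        | succ n => exact congrArg (· + 1) (if_pos (hφ n hn))
      rw [h₁, ← sat_ren, h₂, Fm.ren_id, extT]
    have hz : scons z id ∘ up g = scons z g := by funext n; cases n <;> rfl
    rw [extT, sat_ren, hz, sat_goodUnion, hg, key L fun n hn => .inl (.inl hn),
      key Le fun n hn => .inl (.inr hn), key Φ fun n hn => .inr hn]

theorem proves_of_forces {φ ψ : Fm} (h : ∀ w : World [φ], w ⊩ sat ψ id) :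
    Prf CZFMinus [φ] ψ :=
  forces_sat_id.1 (h ⟨[φ], List.Subset.refl _⟩)

theorem forcesAID (L Le Φ : Fm) (B : ℕ) : ForcesAID
    [isAbstractInductiveDefinition (cls L) (cls Le) (param B) (cls Φ) 0] L Le B Φ := fun w => by
  rw [← sat_isAbstractInductiveDefinition]
  exact forces_sat_id.2 (.hyp (w.sub List.mem_cons_self))

end CST

open CST
theorem mainTheorem1 (L Le Φ : Fm) (B : ℕ) :
    ∃ J : Fm,
      (∀ n : ℕ, n + 1 ∈ J.fv → n = B ∨ n + 1 ∈ L.fv ∪ Le.fv ∪ Φ.fv) ∧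
      CZFMinusProves
        (isAbstractInductiveDefinition (cls L) (cls Le) (param B) (cls Φ) →ₛ
          isIteration (cls L) (cls Le) (param B) (cls Φ) (cls J)) ∧
      CZFMinusProves
        (isAbstractInductiveDefinition (cls L) (cls Le) (param B) (cls Φ) →ₛ
          isPhiClosed (cls L) (cls Le) (param B) (cls Φ)
            (cL (cls L) (cls Le) (param B) (stageInfty (param B) (cls J)))) ∧
      ∀ C : Fm, CZFMinusProves
        (isAbstractInductiveDefinition (cls L) (cls Le) (param B) (cls Φ) →ₛ
          isPhiClosed (cls L) (cls Le) (param B) (cls Φ) (cls C) →ₛ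
            subC (cL (cls L) (cls Le) (param B) (stageInfty (param B) (cls J))) (cls C)) := by
  obtain ⟨J, hfv, hJ⟩ := exists_definesGood L Le Φ B
  have H := forcesAID L Le Φ B
  refine ⟨J, hfv, .impI (proves_of_forces fun w => ?_), .impI (proves_of_forces fun w => ?_),
    fun C => .impI (proves_of_forces fun w => ?_)⟩
  · rw [sat_isIteration]
    exact H.isIteration (hJ _)
  · rw [sat_isPhiClosed_cL]
    exact H.isPhiClosed_cL (hJ _)
  · rw [sat_impF, sat_isPhiClosed, sat_subC_cL]
    exact fun v hv hC => (hJ _).sub_of_isPhiClosed hC
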